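/- **Exponential concentration of data.** There is an absolute constant $C>0$ with the following property. Let $K\ge 1$ and $T\ge 1$ be integers, and let $X\in\mathbb{C}^{K\times T}$ be a random matrix whose entries $X_{k,t}$ are independent (not necessarily identically distributed), have zero mean, and are bounded, with $$\|X\|_\infty := \max_{k,t}\ \operatorname{ess\,sup}|X_{k,t}| = \frac{S_\infty}{\sqrt T},$$ and suppose that $\mathbb{E}[XX^{H}]=I_K$. Then for every $\delta>0$ with $T\ge C^2K/\delta^2$, $$\Pr\left[\frac{\|XX^{H}-I_K\|_F}{\sqrt K}\ \ge\ \frac{1}{\ln 2}\,S_\infty^2\max\{\delta,\delta^2\}\right]\ <\ 2\exp\left(-\Big(\frac{\delta\sqrt T}{C}-\sqrt K\Big)^2\right),$$ where $\|\cdot\|_F$ denotes the Frobenius norm and $X^{H}$ the conjugate transpose of $X$. -/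

import Mathlib

open MeasureTheory ProbabilityTheory
open scoped ENNReal Matrix Matrix.Norms.Frobenius

/-- The entrywise expectation `E[M]` of a random complex matrix `M`. -/
noncomputable def matrixExpectation {Ω m n : Type*} [MeasurableSpace Ω]
    (P : Measure Ω) (M : Ω → Matrix m n ℂ) : Matrix m n ℂ :=
  Matrix.of fun i j => ∫ ω, M ω i j ∂P

/-- The quantity `‖X‖_∞` of a random complex matrix `X`: the largest essential supremum of the
moduli of its entries, as an extended nonnegative real (it is `∞` if some entry is unbounded). -/
noncomputable def entrySupNorm {Ω m n : Type*} [MeasurableSpace Ω]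
    (P : Measure Ω) (X : Ω → Matrix m n ℂ) : ℝ≥0∞ :=
  ⨆ i : m, ⨆ j : n, eLpNorm (fun ω => X ω i j) ∞ P

/-! Put $M = S_\infty/\sqrt T$. For a unit vector $v$, the coordinates of $v^H X$ are independent
over the columns, and by Hoeffding's lemma the real and imaginary parts of each are sub-Gaussian
with parameter $M^2$. Hence $|(v^H X)_t|^2/(8M^2)$ has exponential moment at most $2$, and
Bernstein's inequality concentrates $v^H X X^H v$ around its mean $1$
(`measureReal_quadraticForm_deviation_le`).

For a Hermitian matrix, $\|A\|_F/\sqrt K$ is at most the largest $|\lambda_i|$, which is at most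
twice the largest $|v^H A v|$ over a $1/2$-net of the sphere. A union bound over a net of at most
$25^K$ points costs $e^{4K}$, which the hypothesis on $T$ lets the Bernstein exponent absorb. -/

/-- Independent random variables indexed by pairs stay independent when grouped into tuples
along the first index. -/
theorem iIndepFun_curry {Ω ι κ E : Type*} [Countable ι] [Countable κ] [MeasurableSpace Ω]
    [MeasurableSpace E] {P : Measure Ω} {X : ι → κ → Ω → E} (hX : ∀ i j, Measurable (X i j))
    (h : iIndepFun (fun p : ι × κ => X p.1 p.2) P) :
    iIndepFun (fun i ω j => X i j ω) P := by
  have := h.isProbabilityMeasure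
  have hp : ∀ i j, IsProbabilityMeasure (P.map (X i j)) :=
    fun i j ↦ Measure.isProbabilityMeasure_map (hX i j).aemeasurable
  have hi (i : ι) : iIndepFun (X i) P := h.precomp (g := fun j => (i, j)) (Prod.mk_right_injective i)
  rw [iIndepFun_iff_map_fun_eq_infinitePi_map (by fun_prop)] at h ⊢
  have hc : (fun ω i j => X i j ω)
      = (MeasurableEquiv.curry ι κ E) ∘ fun ω (p : ι × κ) => X p.1 p.2 ω := by
    ext; rfl
  rw [hc, ← Measure.map_map (by fun_prop) (by fun_prop), h,
    Measure.infinitePi_map_curry (fun i j => P.map (X i j))]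
  congr 1
  funext i
  exact ((iIndepFun_iff_map_fun_eq_infinitePi_map (by fun_prop)).1 (hi i)).symm

/-- The second-order Taylor remainder is at most $(rw)^2 e^{|rw|}$. As $|r| \le 1/2$, half of the
weight $e^{|w|}$ covers $e^{|rw|}$ and the other half covers $w^2$. -/
theorem exp_mul_le_quadratic {r : ℝ} (hr : |r| ≤ 1 / 2) (w : ℝ) :
    Real.exp (r * w) ≤ 1 + r * w + 8 * r ^ 2 * Real.exp |w| := by
  have h := Complex.norm_exp_sub_sum_le_norm_mul_exp ((r * w : ℝ) : ℂ) 2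
  have h1 : Complex.exp ((r * w : ℝ) : ℂ) - ∑ m ∈ Finset.range 2, ((r * w : ℝ) : ℂ) ^ m / m.factorial
      = ((Real.exp (r * w) - (1 + r * w) : ℝ) : ℂ) := by
    simp [Finset.sum_range_succ]
  rw [h1, Complex.norm_real, Complex.norm_real, Real.norm_eq_abs, Real.norm_eq_abs, sq_abs] at h
  have h2 : Real.exp |r * w| ≤ Real.exp (|w| / 2) := by
    rw [Real.exp_le_exp, abs_mul]; nlinarith [abs_nonneg w]
  have h3 : w ^ 2 ≤ 8 * Real.exp (|w| / 2) := by
    have := Real.quadratic_le_exp_of_nonneg (x := |w| / 2) (by positivity)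
    have h5 : |w| ^ 2 = w ^ 2 := sq_abs w
    nlinarith [abs_nonneg w]
  have h4 : Real.exp |w| = Real.exp (|w| / 2) * Real.exp (|w| / 2) := by
    rw [← Real.exp_add]; ring_nf
  have h6 : (r * w) ^ 2 * Real.exp |r * w| ≤ 8 * r ^ 2 * Real.exp |w| := by
    rw [h4, mul_pow]
    calc r ^ 2 * w ^ 2 * Real.exp |r * w|
        ≤ r ^ 2 * (8 * Real.exp (|w| / 2)) * Real.exp (|w| / 2) := by gcongr
      _ = _ := by ring
  linarith [le_abs_self (Real.exp (r * w) - (1 + r * w))]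

/-! ### Exponential moments and squares of sub-Gaussian variables -/

section Moments

variable {Ω : Type*} [MeasurableSpace Ω] {P : Measure Ω}

/-- Centring removes the linear term of the quadratic bound. The mean lies in $[0,1]$, so $|U - m|
\le U + 1$ and the remainder is at most $8r^2 \cdot e \cdot 2 \le 48r^2$. -/
theorem mgf_sub_integral_le_of_exp_le_two [IsProbabilityMeasure P] {U : Ω → ℝ}
    (hU : Measurable U) (hU0 : ∀ ω, 0 ≤ U ω)
    (hi : Integrable (fun ω => Real.exp (U ω)) P) (h2 : ∫ ω, Real.exp (U ω) ∂P ≤ 2)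
    {r : ℝ} (hr : |r| ≤ 1 / 2) :
    Integrable (fun ω => Real.exp (r * (U ω - ∫ ω', U ω' ∂P))) P ∧
      mgf (fun ω => U ω - ∫ ω', U ω' ∂P) P r ≤ Real.exp (48 * r ^ 2) := by
  have hUi : Integrable U P := by
    refine hi.mono' hU.aestronglyMeasurable (ae_of_all _ fun ω => ?_)
    rw [Real.norm_eq_abs, abs_of_nonneg (hU0 ω)]
    linarith [Real.add_one_le_exp (U ω)]
  set m := ∫ ω', U ω' ∂P with hm
  have hm0 : 0 ≤ m := integral_nonneg hU0
  have hm1 : m ≤ 1 := by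
    have : ∫ ω, (U ω + 1) ∂P ≤ ∫ ω, Real.exp (U ω) ∂P :=
      integral_mono (hUi.add (integrable_const _)) hi fun ω => Real.add_one_le_exp (U ω)
    rw [integral_add hUi (integrable_const _)] at this
    simp at this
    linarith
  have hb (ω : Ω) : Real.exp (r * (U ω - m))
      ≤ 1 + r * (U ω - m) + 8 * r ^ 2 * (Real.exp 1 * Real.exp (U ω)) := by
    refine (exp_mul_le_quadratic hr _).trans ?_
    rw [← Real.exp_add]
    gcongr
    rw [abs_le]
    constructor <;> linarith [hU0 ω]
  have hbi : Integrable (fun ω => 1 + r * (U ω - m) + 8 * r ^ 2 * (Real.exp 1 * Real.exp (U ω))) P :=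
    (((integrable_const _).add ((hUi.sub (integrable_const _)).const_mul r))).add
      ((hi.const_mul _).const_mul _)
  have hint : Integrable (fun ω => Real.exp (r * (U ω - m))) P := by
    refine hbi.mono' (by fun_prop) (ae_of_all _ fun ω => ?_)
    rw [Real.norm_eq_abs, abs_of_pos (Real.exp_pos _)]
    exact hb ω
  refine ⟨hint, ?_⟩
  have h1 : mgf (fun ω => U ω - m) P r
      ≤ ∫ ω, (1 + r * (U ω - m) + 8 * r ^ 2 * (Real.exp 1 * Real.exp (U ω))) ∂P :=
    integral_mono hint hbi hb
  have h0 : ∫ ω, (U ω - m) ∂P = 0 := by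
    rw [integral_sub hUi (integrable_const _)]; simp [hm]
  have h3 : ∫ ω, (1 + r * (U ω - m) + 8 * r ^ 2 * (Real.exp 1 * Real.exp (U ω))) ∂P
      = 1 + 8 * r ^ 2 * (Real.exp 1 * ∫ ω, Real.exp (U ω) ∂P) := by
    have hUr : Integrable (fun ω => r * (U ω - m)) P :=
      (hUi.sub (integrable_const _)).const_mul r
    rw [integral_add (by fun_prop) (by fun_prop), integral_add (by fun_prop) hUr,
      integral_const_mul, integral_const_mul,
      integral_const_mul, h0]
    simp
  have h4 : Real.exp 1 * ∫ ω, Real.exp (U ω) ∂P ≤ 3 * 2 :=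
    mul_le_mul (by linarith [Real.exp_one_lt_d9]) h2 (integral_nonneg fun _ => (Real.exp_pos _).le)
      (by norm_num)
  rw [h3] at h1
  nlinarith [Real.add_one_le_exp (48 * r ^ 2), sq_nonneg r]

theorem lintegral_exp_sq_div_four_gaussianReal_le :
    ∫⁻ x, ENNReal.ofReal (Real.exp (x ^ 2 / 4)) ∂(gaussianReal 0 1) ≤ 2 := by
  rw [gaussianReal_of_var_ne_zero _ one_ne_zero,
    lintegral_withDensity_eq_lintegral_mul _ (measurable_gaussianPDF _ _) (by fun_prop)]
  have h : ∀ x : ℝ, (gaussianPDF 0 1 * fun x => ENNReal.ofReal (Real.exp (x ^ 2 / 4))) x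
      = ENNReal.ofReal ((√(2 * Real.pi))⁻¹ * Real.exp (-(1 / 4) * x ^ 2)) := by
    intro x
    simp only [Pi.mul_apply, gaussianPDF, gaussianPDFReal]
    rw [← ENNReal.ofReal_mul (by positivity), mul_assoc, ← Real.exp_add]
    congr 3
    · simp
    · simp; ring
  simp_rw [h]
  rw [← ofReal_integral_eq_lintegral_ofReal
    ((integrable_exp_neg_mul_sq (by norm_num)).const_mul _) (ae_of_all _ fun x => by positivity),
    integral_const_mul, integral_gaussian]
  rw [← ENNReal.ofReal_ofNat 2]
  apply ENNReal.ofReal_le_ofReal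
  rw [inv_mul_le_iff₀ (by positivity), Real.sqrt_le_left (by positivity), mul_pow,
    Real.sq_sqrt (by positivity)]
  nlinarith [Real.pi_pos]

/-- The square of a sub-Gaussian random variable is exponentially integrable. -/
theorem lintegral_exp_sq_le_of_hasSubgaussianMGF [IsProbabilityMeasure P] {Y : Ω → ℝ}
    (hY : Measurable Y) {c : NNReal} (hc : 0 < c) (h : HasSubgaussianMGF Y c P) :
    ∫⁻ ω, ENNReal.ofReal (Real.exp (Y ω ^ 2 / (4 * c))) ∂P ≤ 2 := by
  have hc' : (0 : ℝ) < c := hc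
  -- Gaussian linearisation: $e^{Y^2/(4c)} = \mathbb{E}_g e^{sYg}$ for a standard normal $g$. After
  -- swapping the integrals, the sub-Gaussian bound leaves $\mathbb{E}\,e^{g^2/4} = \sqrt2$.
  set s : ℝ := (√(2 * c))⁻¹ with hs
  have hs2 : s ^ 2 = 1 / (2 * c) := by
    rw [hs, inv_pow, Real.sq_sqrt (by positivity)]; simp
  have h1 (ω : Ω) : ENNReal.ofReal (Real.exp (Y ω ^ 2 / (4 * c)))
      = ∫⁻ g, ENNReal.ofReal (Real.exp (s * Y ω * g)) ∂(gaussianReal 0 1) := by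
    rw [← ofReal_integral_eq_lintegral_ofReal (integrable_exp_mul_gaussianReal _)
      (ae_of_all _ fun x => by positivity)]
    have := congrFun (mgf_fun_id_gaussianReal (μ := 0) (v := 1)) (s * Y ω)
    rw [mgf] at this
    rw [this]
    congr 2
    rw [mul_pow, hs2]
    simp; field_simp; norm_num
  simp_rw [h1]
  rw [lintegral_lintegral_swap (by fun_prop)]
  refine le_trans (lintegral_mono fun g => ?_) lintegral_exp_sq_div_four_gaussianReal_le
  have hg : ∀ ω, s * Y ω * g = s * g * Y ω := fun ω => by ring
  simp_rw [hg]
  rw [← ofReal_integral_eq_lintegral_ofReal (h.integrable_exp_mul _)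
      (ae_of_all _ fun x => by positivity)]
  apply ENNReal.ofReal_le_ofReal
  refine (h.mgf_le (s * g)).trans (le_of_eq ?_)
  congr 1
  rw [mul_pow, hs2]
  field_simp; ring

/-- A complex random variable with sub-Gaussian real and imaginary parts has an exponentially
integrable squared modulus. -/
theorem integral_exp_normSq_le_of_hasSubgaussianMGF [IsProbabilityMeasure P] {Z : Ω → ℂ}
    (hZ : Measurable Z) {c : NNReal} (hc : 0 < c) (hre : HasSubgaussianMGF (fun ω => (Z ω).re) c P)
    (him : HasSubgaussianMGF (fun ω => (Z ω).im) c P) :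
    Integrable (fun ω => Real.exp (‖Z ω‖ ^ 2 / (8 * c))) P ∧
      ∫ ω, Real.exp (‖Z ω‖ ^ 2 / (8 * c)) ∂P ≤ 2 := by
  have hc' : (0 : ℝ) < c := hc
  have key : ∫⁻ ω, ENNReal.ofReal (Real.exp (‖Z ω‖ ^ 2 / (8 * c))) ∂P ≤ 2 := by
    have hb (ω : Ω) : ENNReal.ofReal (Real.exp (‖Z ω‖ ^ 2 / (8 * c)))
        ≤ 2⁻¹ * (ENNReal.ofReal (Real.exp ((Z ω).re ^ 2 / (4 * c)))
          + ENNReal.ofReal (Real.exp ((Z ω).im ^ 2 / (4 * c)))) := by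
      rw [← ENNReal.ofReal_add (by positivity) (by positivity),
        show (2⁻¹ : ℝ≥0∞) = ENNReal.ofReal 2⁻¹ by
          rw [ENNReal.ofReal_inv_of_pos (by norm_num)]; simp,
        ← ENNReal.ofReal_mul (by positivity)]
      apply ENNReal.ofReal_le_ofReal
      -- $ab \le (a^2+b^2)/2$ decouples the real and imaginary parts, which may be dependent.
      set a := Real.exp ((Z ω).re ^ 2 / (8 * c))
      set b := Real.exp ((Z ω).im ^ 2 / (8 * c))
      have e1 : Real.exp (‖Z ω‖ ^ 2 / (8 * c)) = a * b := by
        rw [← Real.exp_add, ← Complex.normSq_eq_norm_sq, Complex.normSq_apply]; ring_nf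
      have e2 : Real.exp ((Z ω).re ^ 2 / (4 * c)) = a * a := by
        rw [← Real.exp_add]; congr 1; field_simp; ring
      have e3 : Real.exp ((Z ω).im ^ 2 / (4 * c)) = b * b := by
        rw [← Real.exp_add]; congr 1; field_simp; ring
      rw [e1, e2, e3]
      nlinarith [sq_nonneg (a - b)]
    refine (lintegral_mono hb).trans ?_
    rw [lintegral_const_mul _ (by fun_prop), lintegral_add_left (by fun_prop)]
    have hre' := lintegral_exp_sq_le_of_hasSubgaussianMGF (by fun_prop) hc hre
    have him' := lintegral_exp_sq_le_of_hasSubgaussianMGF (by fun_prop) hc him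
    calc _ ≤ (2⁻¹ : ℝ≥0∞) * (2 + 2) := by gcongr
      _ = 2 := by
        rw [← two_mul, ← mul_assoc, ENNReal.inv_mul_cancel (by simp) (by simp), one_mul]
  have hm : Measurable fun ω => Real.exp (‖Z ω‖ ^ 2 / (8 * c)) := by fun_prop
  refine ⟨⟨hm.aestronglyMeasurable, ?_⟩, ?_⟩
  · rw [hasFiniteIntegral_iff_ofReal (ae_of_all _ fun ω => by positivity)]
    exact key.trans_lt (by simp)
  · rw [integral_eq_lintegral_of_nonneg_ae (ae_of_all _ fun ω => by positivity)
      hm.aestronglyMeasurable]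
    exact ENNReal.toReal_le_of_le_ofReal (by norm_num) (by simpa using key)

end Moments

/-! ### Nets on the sphere -/

/-- The unit sphere of a complex Euclidean space of dimension `K` has a `1/2`-net of at most
`25 ^ K` points. -/
theorem exists_half_net_unit_sphere (K : ℕ) :
    ∃ N : Finset (EuclideanSpace ℂ (Fin K)), N.card ≤ 25 ^ K ∧ (∀ v ∈ N, ‖v‖ = 1) ∧
      ∀ u : EuclideanSpace ℂ (Fin K), ‖u‖ = 1 → ∃ v ∈ N, ‖u - v‖ ≤ 1 / 2 := by
  classical
  let Sep (N : Finset (EuclideanSpace ℂ (Fin K))) : Prop :=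
    (∀ v ∈ N, ‖v‖ = 1) ∧ ∀ v ∈ N, ∀ w ∈ N, v ≠ w → 1 / 2 ≤ ‖v - w‖
  have hcard (N) (hN : Sep N) : N.card ≤ 25 ^ K := by
    have hinj : Function.Injective fun v : EuclideanSpace ℂ (Fin K) => (2 : ℝ) • v :=
      smul_right_injective _ two_ne_zero
    -- Doubling turns $1/2$-separation into the $1$-separation within radius $2$ required here. The
    -- bound $5^{\dim}$ in real dimension $2K$ is $25^K$.
    have h := Besicovitch.card_le_of_separated (N.image fun v => (2 : ℝ) • v) ?_ ?_
    · rw [Finset.card_image_of_injective _ hinj] at h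
      refine h.trans (le_of_eq ?_)
      rw [← Module.finrank_mul_finrank ℝ ℂ (EuclideanSpace ℂ (Fin K)),
        Complex.finrank_real_complex, finrank_euclideanSpace_fin, pow_mul]
      norm_num
    · simp only [Finset.mem_image]
      rintro _ ⟨v, hv, rfl⟩
      simp [norm_smul, hN.1 v hv]
    · simp only [Finset.mem_image]
      rintro _ ⟨v, hv, rfl⟩ _ ⟨w, hw, rfl⟩ hne
      have := hN.2 v hv w hw (fun h => hne (by rw [h]))
      rw [← smul_sub, norm_smul, Real.norm_ofNat]
      linarith
  -- A separated set of maximal cardinality is a net: an uncovered point could be added to it.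
  obtain ⟨N, hN, hNc⟩ := Nat.findGreatest_spec (P := fun n => ∃ N, Sep N ∧ N.card = n)
    (Nat.zero_le (25 ^ K)) ⟨∅, ⟨by simp, by simp⟩, rfl⟩
  refine ⟨N, hcard N hN, hN.1, fun u hu => ?_⟩
  by_contra! hcon
  have hu' : u ∉ N := fun h => by have := hcon u h; norm_num at this
  have hS : Sep (insert u N) := by
    refine ⟨?_, ?_⟩
    · simpa [hu] using hN.1
    · intro v hv w hw hne
      rw [Finset.mem_insert] at hv hw
      rcases hv with rfl | hv <;> rcases hw with rfl | hw
      · exact absurd rfl hne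
      · exact (hcon w hw).le
      · rw [norm_sub_rev]; exact (hcon v hv).le
      · exact hN.2 v hv w hw hne
  have h2 := Nat.le_findGreatest (P := fun n => ∃ N, Sep N ∧ N.card = n)
    (hcard _ hS) ⟨_, hS, rfl⟩
  rw [Finset.card_insert_of_notMem hu', hNc] at h2
  omega

/-! ### Frobenius norm and quadratic forms of Hermitian matrices -/

section LinearAlgebra

variable {n : Type*} [Fintype n] [DecidableEq n]

theorem Matrix.IsHermitian.frobenius_norm_sq {A : Matrix n n ℂ} (hA : A.IsHermitian) :
    ‖A‖ ^ 2 = ∑ i, hA.eigenvalues i ^ 2 := by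
  have h1 : ((‖A‖ ^ 2 : ℝ) : ℂ) = (A * A).trace := by
    rw [Matrix.frobenius_norm_def, ← Real.sqrt_eq_rpow, Real.sq_sqrt (by positivity)]
    push_cast
    simp only [Matrix.trace, Matrix.diag_apply, Matrix.mul_apply]
    refine Finset.sum_congr rfl fun i _ => Finset.sum_congr rfl fun j _ => ?_
    rw [← hA.apply j i, RCLike.star_def, Complex.mul_conj, Complex.normSq_eq_norm_sq]
    norm_cast
  have h2 : (A * A).trace = ((∑ i, hA.eigenvalues i ^ 2 : ℝ) : ℂ) := by
    conv_lhs => rw [hA.spectral_theorem, ← map_mul, Unitary.conjStarAlgAut_apply,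
      Matrix.trace_mul_cycle, Unitary.coe_star_mul_self, one_mul, Matrix.diagonal_mul_diagonal,
      Matrix.trace_diagonal]
    push_cast
    exact Finset.sum_congr rfl fun i _ => (sq _).symm
  exact_mod_cast h1.trans h2

theorem Matrix.IsHermitian.re_dotProduct_mulVec {A : Matrix n n ℂ} (hA : A.IsHermitian)
    (v : EuclideanSpace ℂ n) :
    (star ⇑v ⬝ᵥ A *ᵥ ⇑v).re = ∑ i, hA.eigenvalues i * ‖inner ℂ (hA.eigenvectorBasis i) v‖ ^ 2 := by
  set b := hA.eigenvectorBasis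
  have h1 : star ⇑v ⬝ᵥ A *ᵥ ⇑v = inner ℂ v (Matrix.toEuclideanLin A v) := by
    rw [EuclideanSpace.inner_eq_star_dotProduct, dotProduct_comm]; rfl
  have h2 (i : n) : inner ℂ (b i) (Matrix.toEuclideanLin A v)
      = (hA.eigenvalues i : ℂ) * inner ℂ (b i) v := by
    rw [← (Matrix.isSymmetric_toEuclideanLin_iff.mpr hA) (b i) v]
    have : Matrix.toEuclideanLin A (b i) = (hA.eigenvalues i : ℂ) • b i := by
      ext j
      have := congrFun (hA.mulVec_eigenvectorBasis i) j
      simpa [Matrix.toLpLin_apply] using this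
    rw [this, inner_smul_left]; simp
  rw [h1, ← b.sum_inner_mul_inner, Complex.re_sum]
  refine Finset.sum_congr rfl fun i _ => ?_
  rw [h2, mul_left_comm, ← inner_conj_symm, mul_comm ((starRingEnd ℂ) _), Complex.mul_conj,
    Complex.normSq_eq_norm_sq, ← Complex.ofReal_mul, Complex.ofReal_re]

/-- A quadratic form on a half-net controls the Frobenius norm. -/
theorem Matrix.IsHermitian.exists_frobenius_norm_le_of_net [Nonempty n] {A : Matrix n n ℂ}
    (hA : A.IsHermitian)
    {N : Finset (EuclideanSpace ℂ n)} (hN1 : ∀ v ∈ N, ‖v‖ = 1)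
    (hN : ∀ u : EuclideanSpace ℂ n, ‖u‖ = 1 → ∃ v ∈ N, ‖u - v‖ ≤ 1 / 2) :
    ∃ v ∈ N, ‖A‖ / √(Fintype.card n) ≤ 2 * |(star ⇑v ⬝ᵥ A *ᵥ ⇑v).re| := by
  obtain ⟨i, hi⟩ := Finite.exists_max fun i => |hA.eigenvalues i|
  set b := hA.eigenvectorBasis
  have hbi : ‖b i‖ = 1 := b.orthonormal.1 i
  obtain ⟨v, hv, hd⟩ := hN (b i) hbi
  refine ⟨v, hv, ?_⟩
  set l := |hA.eigenvalues i|
  have hF : ‖A‖ / √(Fintype.card n) ≤ l := by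
    rw [div_le_iff₀ (by positivity)]
    refine (sq_le_sq₀ (norm_nonneg _) (by positivity)).1 ?_
    rw [hA.frobenius_norm_sq, mul_pow, Real.sq_sqrt (by positivity), mul_comm, ← nsmul_eq_mul]
    refine Finset.sum_le_card_nsmul _ _ _ fun j _ => ?_
    rw [← sq_abs]
    exact pow_le_pow_left₀ (abs_nonneg _) (hi j) 2
  refine hF.trans ?_
  have hsum : ∑ j, ‖inner ℂ (b j) v‖ ^ 2 = 1 := by
    rw [b.sum_sq_norm_inner_right, hN1 v hv, one_pow]
  set a := ‖inner ℂ (b i) v‖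
  -- $2 - 2\,\mathrm{Re}\langle b_i, v\rangle \le 1/4$. Then the quadratic form is at least $l(2a^2
  -- - 1) \ge l/2$ in modulus.
  have ha : 7 / 8 ≤ a := by
    have h1 := norm_sub_sq (𝕜 := ℂ) (b i) v
    rw [hbi, hN1 v hv] at h1
    have h2 : RCLike.re (inner ℂ (b i) v) ≤ a := RCLike.re_le_norm _
    have h3 : ‖b i - v‖ ^ 2 ≤ (1 / 2) ^ 2 := pow_le_pow_left₀ (norm_nonneg _) hd 2
    linarith
  have hrest : |∑ j ∈ Finset.univ.erase i, hA.eigenvalues j * ‖inner ℂ (b j) v‖ ^ 2|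
      ≤ l * (1 - a ^ 2) := by
    have h1 : ∑ j ∈ Finset.univ.erase i, ‖inner ℂ (b j) v‖ ^ 2 = 1 - a ^ 2 := by
      rw [← hsum, ← Finset.add_sum_erase _ _ (Finset.mem_univ i)]; ring
    rw [← h1, Finset.mul_sum]
    refine (Finset.abs_sum_le_sum_abs _ _).trans (Finset.sum_le_sum fun j _ => ?_)
    rw [abs_mul, abs_of_nonneg (sq_nonneg ‖inner ℂ (b j) v‖)]
    exact mul_le_mul_of_nonneg_right (hi j) (by positivity)
  rw [hA.re_dotProduct_mulVec, ← Finset.add_sum_erase _ _ (Finset.mem_univ i)]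
  have h5 : |hA.eigenvalues i * ‖inner ℂ (b i) v‖ ^ 2| = l * a ^ 2 := by
    rw [abs_mul, abs_of_nonneg (sq_nonneg ‖inner ℂ (b i) v‖)]
  have h6 := abs_sub_abs_le_abs_add (hA.eigenvalues i * ‖inner ℂ (b i) v‖ ^ 2)
    (∑ j ∈ Finset.univ.erase i, hA.eigenvalues j * ‖inner ℂ (b j) v‖ ^ 2)
  have hl : 0 ≤ l := abs_nonneg _
  nlinarith [mul_nonneg hl (sub_nonneg.2 ha), mul_nonneg hl (mul_nonneg (sub_nonneg.2 ha) (sub_nonneg.2 ha))]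

end LinearAlgebra

/-! ### Hoeffding and Bernstein bounds at a fixed vector -/

section Concentration

variable {Ω : Type*} [MeasurableSpace Ω] {P : Measure Ω} [IsProbabilityMeasure P]

/-- A real linear functional of norm at most one, applied to a unit combination of independent
centred complex random variables bounded by `M`, is sub-Gaussian with parameter `M ^ 2`. -/
theorem hasSubgaussianMGF_clm_sum {ι : Type*} [Fintype ι] {Y : ι → Ω → ℂ}
    (hY : ∀ i, Measurable (Y i)) (hind : iIndepFun Y P) (h0 : ∀ i, ∫ ω, Y i ω ∂P = 0) {M : NNReal}
    (hM : ∀ i, ∀ᵐ ω ∂P, ‖Y i ω‖ ≤ M) {a : ι → ℂ} (ha : ∑ i, ‖a i‖ ^ 2 = 1)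
    (L : ℂ →L[ℝ] ℝ) (hL : ∀ z, |L z| ≤ ‖z‖) :
    HasSubgaussianMGF (fun ω => L (∑ i, a i * Y i ω)) (M ^ 2) P := by
  have hi (i : ι) : HasSubgaussianMGF (fun ω => L (a i * Y i ω)) ((‖a i‖₊ * M) ^ 2) P := by
    have hb : ∀ᵐ ω ∂P, L (a i * Y i ω) ∈ Set.Icc (-(‖a i‖ * M)) (‖a i‖ * M) := by
      filter_upwards [hM i] with ω hω
      refine abs_le.1 ?_
      refine (hL _).trans ?_
      rw [norm_mul]
      gcongr
    have hint : Integrable (Y i) P :=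
      Integrable.of_bound (hY i).aestronglyMeasurable M (hM i)
    have h := hasSubgaussianMGF_of_mem_Icc_of_integral_eq_zero (μ := P)
      (X := fun ω => L (a i * Y i ω)) (L.measurable.comp ((hY i).const_mul _)).aemeasurable hb (by
        rw [L.integral_comp_comm (hint.const_mul _), integral_const_mul, h0]; simp)
    convert h using 2
    -- Hoeffding's parameter is the squared half-width of the interval.
    rw [sub_neg_eq_add, ← two_mul, nnnorm_mul, nnnorm_mul]
    ext
    simp
  have hind' : iIndepFun (fun i ω => L (a i * Y i ω)) P :=
    hind.comp (fun i z => L (a i * z)) fun i => L.measurable.comp (measurable_const_mul _)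
  have h := HasSubgaussianMGF.sum_of_iIndepFun hind' (s := Finset.univ) fun i _ => hi i
  convert h using 1
  · funext ω
    rw [map_sum]
  · simp_rw [mul_pow]
    rw [← Finset.sum_mul]
    have : ∑ i, ‖a i‖₊ ^ 2 = 1 := by
      ext; push_cast; exact ha
    rw [this, one_mul]

/-- Bernstein's inequality for nonnegative variables with exponential moments bounded by `2`. -/
theorem measureReal_abs_sum_sub_ge_le {ι : Type*} [Fintype ι] {U : ι → Ω → ℝ}
    (hU : ∀ i, Measurable (U i)) (hU0 : ∀ i ω, 0 ≤ U i ω) (hind : iIndepFun U P)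
    (hi : ∀ i, Integrable (fun ω => Real.exp (U i ω)) P)
    (h2 : ∀ i, ∫ ω, Real.exp (U i ω) ∂P ≤ 2) {r : ℝ} (hr0 : 0 ≤ r) (hr : r ≤ 1 / 2) (ε : ℝ) :
    P.real {ω | ε ≤ |∑ i, (U i ω - ∫ ω', U i ω' ∂P)|}
      ≤ 2 * Real.exp (-r * ε + 48 * r ^ 2 * Fintype.card ι) := by
  set W : ι → Ω → ℝ := fun i ω => U i ω - ∫ ω', U i ω' ∂P with hW
  have hWm (i) : Measurable (W i) := (hU i).sub_const _
  have hWind : iIndepFun W P := hind.comp (fun i x => x - ∫ ω', U i ω' ∂P) fun i => by fun_prop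
  have hsum (s : ℝ) (hs : |s| ≤ 1 / 2) :
      Integrable (fun ω => Real.exp (s * (∑ i, W i) ω)) P ∧
        mgf (∑ i, W i) P s ≤ Real.exp (48 * s ^ 2 * Fintype.card ι) := by
    have h (i) := mgf_sub_integral_le_of_exp_le_two (hU i) (hU0 i) (hi i) (h2 i) hs
    refine ⟨hWind.integrable_exp_mul_sum hWm fun i _ => (h i).1, ?_⟩
    rw [hWind.mgf_sum hWm]
    refine (Finset.prod_le_prod (fun i _ => mgf_nonneg) fun i _ => (h i).2).trans (le_of_eq ?_)
    rw [Finset.prod_const, ← Real.exp_nat_mul, Finset.card_univ]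
    ring_nf
  have hsub : {ω | ε ≤ |∑ i, W i ω|}
      ⊆ {ω | ε ≤ (∑ i, W i) ω} ∪ {ω | (∑ i, W i) ω ≤ -ε} := by
    intro ω hω
    simp only [Set.mem_ofPred_eq, Set.mem_union, Finset.sum_apply] at hω ⊢
    rcases le_abs.1 hω with h | h
    · exact Or.inl h
    · exact Or.inr (by linarith)
  obtain ⟨i1, m1⟩ := hsum r (by rwa [abs_of_nonneg hr0])
  obtain ⟨i2, m2⟩ := hsum (-r) (by rwa [abs_neg, abs_of_nonneg hr0])
  have p1 := measure_ge_le_exp_mul_mgf ε hr0 i1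
  have p2 := measure_le_le_exp_mul_mgf (-ε) (neg_nonpos.2 hr0) i2
  rw [neg_sq] at m2
  have e1 : - -r * -ε = -r * ε := by ring
  rw [e1] at p2
  calc P.real {ω | ε ≤ |∑ i, W i ω|}
      ≤ P.real {ω | ε ≤ (∑ i, W i) ω} + P.real {ω | (∑ i, W i) ω ≤ -ε} :=
        (measureReal_mono hsub).trans (measureReal_union_le _ _)
    _ ≤ Real.exp (-r * ε) * Real.exp (48 * r ^ 2 * Fintype.card ι)
        + Real.exp (-r * ε) * Real.exp (48 * r ^ 2 * Fintype.card ι) := by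
        gcongr
        · exact p1.trans (by gcongr)
        · exact p2.trans (by gcongr)
    _ = _ := by rw [Real.exp_add]; ring

theorem ofReal_sum_norm_sq_eq_dotProduct {m n : Type*} [Fintype m] [Fintype n]
    (A : Matrix m n ℂ) (v : m → ℂ) :
    ((∑ t, ‖∑ k, star (v k) * A k t‖ ^ 2 : ℝ) : ℂ) = star v ⬝ᵥ (A * Aᴴ) *ᵥ v := by
  have h : star v ⬝ᵥ (A * Aᴴ) *ᵥ v = (star v ᵥ* A) ⬝ᵥ star (star v ᵥ* A) := by
    rw [← Matrix.mulVec_mulVec, Matrix.dotProduct_mulVec, Matrix.star_vecMul, star_star]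
  rw [h]
  push_cast
  refine Finset.sum_congr rfl fun t _ => ?_
  rw [Pi.star_apply, RCLike.star_def, Complex.mul_conj, Complex.normSq_eq_norm_sq]
  norm_cast

theorem integral_sum_norm_sq_of_matrixExpectation {m n : Type*} [Fintype m] [Fintype n]
    [DecidableEq m] {X : Ω → Matrix m n ℂ} (hX : ∀ k t, Measurable fun ω => X ω k t) {M : ℝ}
    (hM : ∀ k t, ∀ᵐ ω ∂P, ‖X ω k t‖ ≤ M)
    (hE : matrixExpectation P (fun ω => X ω * (X ω)ᴴ) = 1) (v : m → ℂ)
    (hv : ∑ k, ‖v k‖ ^ 2 = 1) :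
    ∫ ω, ∑ t, ‖∑ k, star (v k) * X ω k t‖ ^ 2 ∂P = 1 := by
  have hint (k l : m) : Integrable (fun ω => (X ω * (X ω)ᴴ) k l) P := by
    simp only [Matrix.mul_apply, Matrix.conjTranspose_apply]
    refine integrable_finsetSum _ fun t _ => ?_
    refine Integrable.of_bound ((hX k t).mul (continuous_star.measurable.comp (hX l t))).aestronglyMeasurable (M * M) ?_
    filter_upwards [hM k t, hM l t] with ω h1 h2
    rw [norm_mul, norm_star]
    exact mul_le_mul h1 h2 (norm_nonneg _) ((norm_nonneg _).trans h1)
  have hval (k l : m) : ∫ ω, (X ω * (X ω)ᴴ) k l ∂P = (1 : Matrix m m ℂ) k l :=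
    congrFun (congrFun hE k) l
  have h : ∫ ω, ((∑ t, ‖∑ k, star (v k) * X ω k t‖ ^ 2 : ℝ) : ℂ) ∂P = 1 := by
    simp_rw [ofReal_sum_norm_sq_eq_dotProduct (X _) v]
    simp only [dotProduct, Matrix.mulVec]
    rw [integral_finsetSum _ fun k _ => (integrable_finsetSum _ fun l _ =>
      (hint k l).mul_const _).const_mul _]
    have (k : m) : ∫ ω, star v k * ∑ l, (X ω * (X ω)ᴴ) k l * v l ∂P = ((‖v k‖ ^ 2 : ℝ) : ℂ) := by
      rw [integral_const_mul, integral_finsetSum _ fun l _ => (hint k l).mul_const _]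
      simp_rw [integral_mul_const, hval]
      rw [Pi.star_apply, RCLike.star_def, mul_comm]
      simp [Matrix.one_apply, Complex.mul_conj, Complex.normSq_eq_norm_sq]
    simp_rw [this]
    rw [← Complex.ofReal_sum, hv, Complex.ofReal_one]
  rw [integral_complex_ofReal] at h
  exact_mod_cast h

/-- Concentration of the quadratic form `v ↦ vᴴ X Xᴴ v` at a fixed unit vector. -/
theorem measureReal_quadraticForm_deviation_le {m n : Type*} [Fintype m] [Fintype n]
    [DecidableEq m] {X : Ω → Matrix m n ℂ} (hX : ∀ k t, Measurable fun ω => X ω k t)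
    (hind : iIndepFun (fun (p : m × n) (ω : Ω) => X ω p.1 p.2) P)
    (h0 : ∀ k t, ∫ ω, X ω k t ∂P = 0) {M : NNReal} (hM0 : 0 < M)
    (hM : ∀ k t, ∀ᵐ ω ∂P, ‖X ω k t‖ ≤ M)
    (hE : matrixExpectation P (fun ω => X ω * (X ω)ᴴ) = 1) (v : EuclideanSpace ℂ m)
    (hv : ‖v‖ = 1) {r : ℝ} (hr0 : 0 ≤ r) (hr : r ≤ 1 / 2) (ε : ℝ) :
    P.real {ω | 8 * (M : ℝ) ^ 2 * ε ≤ |(star ⇑v ⬝ᵥ (X ω * (X ω)ᴴ - 1) *ᵥ ⇑v).re|}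
      ≤ 2 * Real.exp (-r * ε + 48 * r ^ 2 * Fintype.card n) := by
  have hM0' : (0 : ℝ) < M := hM0
  have hv2 : ∑ k, ‖v k‖ ^ 2 = 1 := by
    rw [← EuclideanSpace.norm_sq_eq, hv, one_pow]
  set Z : n → Ω → ℂ := fun t ω => ∑ k, star (v k) * X ω k t with hZ
  have hZm (t) : Measurable (Z t) := Finset.measurable_fun_sum _ fun k _ => (hX k t).const_mul _
  have hsub (t : n) (L : ℂ →L[ℝ] ℝ) (hL : ∀ z, |L z| ≤ ‖z‖) :
      HasSubgaussianMGF (fun ω => L (Z t ω)) (M ^ 2) P :=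
    hasSubgaussianMGF_clm_sum (Y := fun k ω => X ω k t) (fun k => hX k t)
      (hind.precomp (g := fun k => (k, t)) (Prod.mk_left_injective t)) (fun k => h0 k t)
      (fun k => hM k t) (by simpa using hv2) L hL
  have hexp (t : n) := integral_exp_normSq_le_of_hasSubgaussianMGF (hZm t) (pow_pos hM0 2)
    (hsub t Complex.reCLM Complex.abs_re_le_norm) (hsub t Complex.imCLM Complex.abs_im_le_norm)
  simp only [NNReal.coe_pow] at hexp
  set U : n → Ω → ℝ := fun t ω => ‖Z t ω‖ ^ 2 / (8 * (M : ℝ) ^ 2) with hU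
  have hUind : iIndepFun U P := by
    have h1 : iIndepFun (fun t ω k => X ω k t) P :=
      iIndepFun_curry (X := fun t k ω => X ω k t) (fun t k => hX k t)
        (hind.precomp (g := Prod.swap) Prod.swap_injective)
    exact h1.comp (fun t x => ‖∑ k, star (v k) * x k‖ ^ 2 / (8 * (M : ℝ) ^ 2))
      fun t => by fun_prop
  have hUi (t) : Integrable (U t) P := by
    refine (hexp t).1.mono' (by fun_prop) (ae_of_all _ fun ω => ?_)
    have : 0 ≤ U t ω := by positivity
    rw [Real.norm_eq_abs, abs_of_nonneg this]
    linarith [Real.add_one_le_exp (U t ω)]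
  have hmean : ∑ t, ∫ ω, U t ω ∂P = 1 / (8 * (M : ℝ) ^ 2) := by
    rw [← integral_finsetSum _ fun t _ => hUi t,
      ← integral_sum_norm_sq_of_matrixExpectation hX hM hE v hv2, ← integral_div]
    simp only [hU, hZ, Finset.sum_div]
  refine le_trans (measureReal_mono fun ω hω => ?_)
    (measureReal_abs_sum_sub_ge_le (fun t => by fun_prop) (fun t ω => by positivity) hUind
      (fun t => (hexp t).1) (fun t => (hexp t).2) hr0 hr ε)
  simp only [Set.mem_ofPred_eq] at hω ⊢
  have hq : (star ⇑v ⬝ᵥ (X ω * (X ω)ᴴ - 1) *ᵥ ⇑v).re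
      = 8 * (M : ℝ) ^ 2 * ∑ t, (U t ω - ∫ ω', U t ω' ∂P) := by
    rw [Finset.sum_sub_distrib, hmean, Matrix.sub_mulVec, dotProduct_sub, Complex.sub_re,
      ← ofReal_sum_norm_sq_eq_dotProduct, Complex.ofReal_re, Matrix.one_mulVec]
    have h1 : (star ⇑v ⬝ᵥ ⇑v).re = 1 := by
      rw [← hv2, dotProduct, Complex.re_sum]
      refine Finset.sum_congr rfl fun k _ => ?_
      rw [Pi.star_apply, RCLike.star_def, mul_comm, Complex.mul_conj, Complex.ofReal_re,
        Complex.normSq_eq_norm_sq]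
    rw [h1, mul_sub, ← Finset.sum_div]
    field_simp
    rfl
  rw [hq, abs_mul, abs_of_pos (by positivity)] at hω
  exact le_of_mul_le_mul_left hω (by positivity)

end Concentration

/-! ### Union bound and choice of constants -/

theorem ae_norm_le_toNNReal_of_entrySupNorm {Ω m n : Type*} [MeasurableSpace Ω] {P : Measure Ω}
    {X : Ω → Matrix m n ℂ} {c : ℝ} (h : entrySupNorm P X = ENNReal.ofReal c) (k : m) (t : n) :
    ∀ᵐ ω ∂P, ‖X ω k t‖ ≤ c.toNNReal := by
  have h1 : eLpNorm (fun ω => X ω k t) ∞ P ≤ ENNReal.ofReal c := by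
    rw [← h]
    exact le_iSup₂ (f := fun i j => eLpNorm (fun ω => X ω i j) ∞ P) k t
  rw [eLpNorm_exponent_top] at h1
  filter_upwards [ae_le_eLpNormEssSup (f := fun ω => X ω k t) (μ := P)] with ω hω
  exact_mod_cast enorm_le_coe.1 (hω.trans h1)

/-- Since $25 < e^4$ and $K \le x^2$, one has $4K + (x - \sqrt K)^2 \le 6x^2 < 21x^2$. -/
theorem twentyFive_pow_mul_exp_lt {K : ℕ} (hK : 1 ≤ K) {x : ℝ} (hx : √(K : ℝ) ≤ x) :
    25 ^ K * (2 * Real.exp (-(21 * x ^ 2))) < 2 * Real.exp (-((x - √(K : ℝ)) ^ 2)) := by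
  have hK' : (1 : ℝ) ≤ K := by exact_mod_cast hK
  have hs : √(K : ℝ) ^ 2 = K := Real.sq_sqrt (by positivity)
  have hs0 : 0 ≤ √(K : ℝ) := Real.sqrt_nonneg _
  have h25 : (25 : ℝ) ^ K ≤ Real.exp (4 * K) := by
    have : (25 : ℝ) ≤ Real.exp 4 := by
      have h1 : Real.exp 4 = Real.exp 1 ^ 4 := by rw [← Real.exp_nat_mul]; norm_num
      have h2 : (2.7 : ℝ) ^ 4 ≤ Real.exp 1 ^ 4 :=
        pow_le_pow_left₀ (by norm_num) (by linarith [Real.exp_one_gt_d9]) 4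
      rw [h1]
      exact le_trans (by norm_num) h2
    calc (25 : ℝ) ^ K ≤ Real.exp 4 ^ K := by gcongr
      _ = Real.exp (4 * K) := by rw [← Real.exp_nat_mul]; ring_nf
  calc (25 : ℝ) ^ K * (2 * Real.exp (-(21 * x ^ 2)))
      ≤ Real.exp (4 * K) * (2 * Real.exp (-(21 * x ^ 2))) := by gcongr
    _ = 2 * Real.exp (4 * K - 21 * x ^ 2) := by rw [sub_eq_add_neg, Real.exp_add]; ring
    _ < _ := by
      gcongr
      nlinarith

/-- Exponential concentration of data. The norm `‖·‖` of a matrix is the Frobenius norm. -/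
theorem proposition1 :
    ∃ C : ℝ, 0 < C ∧
      ∀ (K T : ℕ), 1 ≤ K →
      ∀ {Ω : Type*} [MeasurableSpace Ω] (P : Measure Ω) [IsProbabilityMeasure P]
        (X : Ω → Matrix (Fin K) (Fin T) ℂ) (S : ℝ),
        (∀ k t, Measurable (fun ω => X ω k t)) →
        iIndepFun (fun (p : Fin K × Fin T) (ω : Ω) => X ω p.1 p.2) P →
        (∀ k t, ∫ ω, X ω k t ∂P = 0) →
        entrySupNorm P X = ENNReal.ofReal (S / √(T : ℝ)) →
        matrixExpectation P (fun ω => X ω * (X ω)ᴴ) = 1 →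
        ∀ δ : ℝ, 0 < δ → C ^ 2 * (K : ℝ) / δ ^ 2 ≤ (T : ℝ) →
          P.real {ω | 1 / Real.log 2 * S ^ 2 * max δ (δ ^ 2)
              ≤ ‖X ω * (X ω)ᴴ - 1‖ / √(K : ℝ)}
            < 2 * Real.exp (-((δ * √(T : ℝ) / C - √(K : ℝ)) ^ 2)) := by
  refine ⟨1024, by norm_num, ?_⟩
  intro K T hK Ω _ P _ X S hX hind h0 hS hE δ hδ hT
  have : Nonempty (Fin K) := ⟨⟨0, hK⟩⟩
  have hK0 : (0 : ℝ) < K := by exact_mod_cast hK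
  have hM := ae_norm_le_toNNReal_of_entrySupNorm hS
  have hT0 : (0 : ℝ) < T := lt_of_lt_of_le (by positivity) hT
  obtain ⟨N, hNc, hN1, hN⟩ := exists_half_net_unit_sphere K
  -- If the bound vanished, $X$ would be almost surely $0$, contradicting $\mathbb{E}[XX^H] = I$.
  have hM0 : 0 < (S / √(T : ℝ)).toNNReal := by
    rw [pos_iff_ne_zero]
    intro hzero
    have hv : ∑ k, ‖(Pi.single ⟨0, hK⟩ 1 : Fin K → ℂ) k‖ ^ 2 = 1 := by
      rw [Finset.sum_eq_single ⟨0, hK⟩] <;> simp +contextual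
    have h1 := integral_sum_norm_sq_of_matrixExpectation hX hM hE _ hv
    have hX0 : ∀ᵐ ω ∂P, ∀ k t, X ω k t = 0 := by
      rw [ae_all_iff]; intro k; rw [ae_all_iff]; intro t
      filter_upwards [hM k t] with ω hω
      rw [hzero] at hω
      exact norm_le_zero_iff.1 (by simpa using hω)
    rw [integral_congr_ae (g := fun _ => (0 : ℝ)) (by
      filter_upwards [hX0] with ω hω
      simp [hω])] at h1
    simp at h1
  set M := (S / √(T : ℝ)).toNNReal with hMdef
  have hM2 : (M : ℝ) ^ 2 = S ^ 2 / T := by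
    rw [hMdef, Real.coe_toNNReal _ (Real.toNNReal_pos.1 hM0).le, div_pow, Real.sq_sqrt hT0.le]
  -- Chosen so that $8M^2\varepsilon$ is half of $S^2\max\{\delta,\delta^2\}$, the half being lost
  -- to the net.
  set ε : ℝ := T * max δ (δ ^ 2) / 16 with hε
  -- For $\delta \le 1$ this is the minimiser $\varepsilon/(96T)$ of the exponent; the cap keeps $r
  -- \le 1/2$. The exponent is then at most $-T\delta^2/49152$, and $1024^2/49152 > 21$.
  set r : ℝ := min 1 δ / 1536 with hr
  have hr0 : 0 ≤ r := by positivity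
  have hr1 : r ≤ 1 / 2 := by rw [hr]; linarith [min_le_left 1 δ]
  have hprod : min 1 δ * max δ (δ ^ 2) = δ ^ 2 := by
    rcases le_total δ 1 with h | h
    · rw [min_eq_right h, max_eq_left (by nlinarith)]; ring
    · rw [min_eq_left h, max_eq_right (by nlinarith)]; ring
  have hexpo : -r * ε + 48 * r ^ 2 * T ≤ -(21 * (δ * √(T : ℝ) / 1024) ^ 2) := by
    have e1 : r * ε = T * δ ^ 2 / 24576 := by rw [← hprod, hr, hε]; ring
    have e2 : r ^ 2 ≤ δ ^ 2 / 1536 ^ 2 := by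
      rw [← div_pow]
      exact pow_le_pow_left₀ hr0 (by rw [hr]; gcongr; exact min_le_right _ _) 2
    have e3 : (δ * √(T : ℝ) / 1024) ^ 2 = T * δ ^ 2 / 1024 ^ 2 := by
      rw [div_pow, mul_pow, Real.sq_sqrt hT0.le]; ring
    have e4 : r ^ 2 * T ≤ δ ^ 2 / 1536 ^ 2 * T := by gcongr
    have e5 : 0 < T * δ ^ 2 := by positivity
    rw [e3]
    linarith
  have hx : √(K : ℝ) ≤ δ * √(T : ℝ) / 1024 := by
    rw [le_div_iff₀ (by norm_num)]
    refine (sq_le_sq₀ (by positivity) (by positivity)).1 ?_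
    rw [mul_pow, mul_pow, Real.sq_sqrt hT0.le, Real.sq_sqrt hK0.le]
    rw [div_le_iff₀ (by positivity)] at hT
    linarith
  refine lt_of_le_of_lt ?_ (twentyFive_pow_mul_exp_lt hK hx)
  have hsub : {ω | 1 / Real.log 2 * S ^ 2 * max δ (δ ^ 2) ≤ ‖X ω * (X ω)ᴴ - 1‖ / √(K : ℝ)}
      ⊆ ⋃ v ∈ N, {ω | 8 * (M : ℝ) ^ 2 * ε
        ≤ |(star ⇑v ⬝ᵥ (X ω * (X ω)ᴴ - 1) *ᵥ ⇑v).re|} := by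
    intro ω hω
    have hH : (X ω * (X ω)ᴴ - 1).IsHermitian :=
      (Matrix.isHermitian_mul_conjTranspose_self _).sub Matrix.isHermitian_one
    obtain ⟨v, hv, hle⟩ := hH.exists_frobenius_norm_le_of_net hN1 hN
    simp only [Set.mem_iUnion, Set.mem_ofPred_eq] at hω ⊢
    refine ⟨v, hv, ?_⟩
    rw [Fintype.card_fin] at hle
    -- The factor $1/\ln 2$ is used only through being at least $1$.
    have hlog : 1 ≤ 1 / Real.log 2 :=
      (one_le_div (Real.log_pos one_lt_two)).2 (by linarith [Real.log_two_lt_d9])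
    have h1 : 8 * (M : ℝ) ^ 2 * ε = S ^ 2 * max δ (δ ^ 2) / 2 := by
      rw [hM2, hε]; field_simp; ring
    have h2 : S ^ 2 * max δ (δ ^ 2) ≤ 1 / Real.log 2 * S ^ 2 * max δ (δ ^ 2) := by
      rw [mul_assoc]
      exact le_mul_of_one_le_left (by positivity) hlog
    linarith
  calc _ ≤ ∑ v ∈ N, P.real {ω | 8 * (M : ℝ) ^ 2 * ε
        ≤ |(star ⇑v ⬝ᵥ (X ω * (X ω)ᴴ - 1) *ᵥ ⇑v).re|} :=
        (measureReal_mono hsub (measure_ne_top _ _)).trans (measureReal_biUnion_finset_le _ _)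
    _ ≤ ∑ _v ∈ N, 2 * Real.exp (-(21 * (δ * √(T : ℝ) / 1024) ^ 2)) := by
        refine Finset.sum_le_sum fun v hv => ?_
        refine (measureReal_quadraticForm_deviation_le hX hind h0 hM0 hM hE v (hN1 v hv)
          hr0 hr1 ε).trans ?_
        rw [Fintype.card_fin]
        gcongr
    _ ≤ 25 ^ K * (2 * Real.exp (-(21 * (δ * √(T : ℝ) / 1024) ^ 2))) := by
        rw [Finset.sum_const, nsmul_eq_mul]
        gcongr
        exact_mod_cast hNc
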